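/- Let $G$ be a discrete group, let $\lambda$ be the left-regular representation of $G$ on $\ell^2(G)$, and let $C^*_\lambda(G)$ be the reduced group C*-algebra, i.e. the norm closure in $B(\ell^2(G))$ of the $*$-algebra generated by $\{\lambda(t) : t \in G\}$. A group is called amenable if there is a left-invariant mean on its bounded real-valued functions. A tracial state is a positive linear functional $\tau$ with $\tau(1)=1$ and $\tau(ab)=\tau(ba)$ for all $a,b$. Then $G$ has a largest amenable normal subgroup $R(G)$ (its amenable radical), and the following hold. 1. For every $t \in G$: $\tau(\lambda(t)) = 0$ for every tracial state $\tau$ on $C^*_\lambda(G)$ if and only if $t \notin R(G)$. 2. $C^*_\lambda(G)$ has a unique tracial state if and only if $R(G) = \{e\}$. -/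

import Mathlib

open scoped ENNReal ComplexOrder

/-- The Hilbert space `ℓ²(G)` of square-summable complex functions on `G`. -/
abbrev EllTwo (G : Type*) : Type _ := lp (fun _ : G => ℂ) 2

theorem memlp_two_leftTranslate {G : Type*} [Group G] (s : G) (f : EllTwo G) :
    Memℓp (fun x : G => f (s⁻¹ * x)) 2 := by
  have h := (lp.memℓp f).summable (by norm_num)
  exact memℓp_gen (h.comp_injective (mul_right_injective s⁻¹))

/-- Left translation by `s` on `ℓ²(G)`, `(λ(s) f)(x) = f(s⁻¹ x)`, as a linear isometry. -/
noncomputable def leftTranslate {G : Type*} [Group G] (s : G) : EllTwo G →ₗᵢ[ℂ] EllTwo G where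
  toFun f := ⟨fun x => f (s⁻¹ * x), memlp_two_leftTranslate s f⟩
  map_add' _ _ := rfl
  map_smul' _ _ := rfl
  norm_map' f := by
    rw [lp.norm_eq_tsum_rpow (by norm_num), lp.norm_eq_tsum_rpow (by norm_num)]
    congr 1
    exact (Equiv.mulLeft s⁻¹).tsum_eq (fun x => ‖f x‖ ^ (2 : ℝ≥0∞).toReal)

/-- The left-regular representation `λ` of the discrete group `G` on `ℓ²(G)`. -/
noncomputable def leftRegular (G : Type*) [Group G] : G →* (EllTwo G →L[ℂ] EllTwo G) where
  toFun s := (leftTranslate s).toContinuousLinearMap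
  map_one' := by
    ext f x
    change f (1⁻¹ * x) = f x
    rw [inv_one, one_mul]
  map_mul' s t := by
    ext f x
    change f ((s * t)⁻¹ * x) = f (t⁻¹ * (s⁻¹ * x))
    rw [mul_inv_rev, mul_assoc]

theorem leftRegular_apply {G : Type*} [Group G] (s : G) (f : EllTwo G) (x : G) :
    leftRegular G s f x = f (s⁻¹ * x) := rfl

/-- The reduced group C*-algebra `C*_λ(G)`: the operator-norm closure, in the bounded operators on
`ℓ²(G)`, of the star-subalgebra generated by the operators `λ(t)`, `t ∈ G`. -/
noncomputable def reducedGroupCStar (G : Type*) [Group G] :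
    StarSubalgebra ℂ (EllTwo G →L[ℂ] EllTwo G) :=
  (StarAlgebra.adjoin ℂ (Set.range (leftRegular G))).topologicalClosure

/-- The operator `λ(t)` as an element of `C*_λ(G)`. -/
noncomputable def reducedGroupCStar.of {G : Type*} [Group G] (t : G) : reducedGroupCStar G :=
  ⟨leftRegular G t, StarSubalgebra.le_topologicalClosure _
    (StarAlgebra.subset_adjoin ℂ _ (Set.mem_range_self t))⟩

/-- A tracial state on a unital star-algebra over `ℂ`: a linear functional that is positive, unital
and tracial. On a unital C*-algebra such a functional is automatically bounded, of norm one;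
`0 ≤ z` for a complex number `z` means that `z` is real and nonnegative. -/
structure IsTracialState {A : Type*} [Ring A] [StarRing A] [Algebra ℂ A] (τ : A →ₗ[ℂ] ℂ) :
    Prop where
  nonneg : ∀ a : A, 0 ≤ τ (star a * a)
  map_one : τ 1 = 1
  map_mul_comm : ∀ a b : A, τ (a * b) = τ (b * a)

/-- A discrete group `G` is amenable if there is a left-invariant mean on the bounded real functions
on `G`: a positive linear functional `m` on `ℓ^∞(G, ℝ)` with `m 1 = 1` which takes the same value
on `f` and on its left translate `g : x ↦ f (s * x)`, for every `s`. -/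
def IsAmenableGroup (G : Type*) [Group G] : Prop :=
  ∃ m : lp (fun _ : G => ℝ) ∞ →ₗ[ℝ] ℝ,
    (∀ f : lp (fun _ : G => ℝ) ∞, (∀ x : G, 0 ≤ f x) → 0 ≤ m f) ∧
    m 1 = 1 ∧
    ∀ (s : G) (f g : lp (fun _ : G => ℝ) ∞), (∀ x : G, g x = f (s * x)) → m g = m f

/-- The amenable radical of `G`, built as the join of all amenable normal subgroups of `G`.
Whenever `G` has a largest amenable normal subgroup, it is this one. -/
def amenableRadical (G : Type*) [Group G] : Subgroup G :=
  sSup {N : Subgroup G | N.Normal ∧ IsAmenableGroup N}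

/-! The argument uses no boundary theory; an algebraic substitute for a boundary is a minimal closed
left ideal `J` of the compact semigroup of means on `ℓ^∞(G)` under the Arens product ψ * k, the
average of the translates g·k over ψ. By minimality every x in `J` generates it
(`exists_arens_eq_of_minimal`), and the subgroup acting trivially on `J` is the largest amenable
normal subgroup. It is normal and fixes a mean, hence is amenable. Conversely, averaging a point of
`J` over an amenable normal M gives an M-fixed point x of `J`, and normality spreads the invariance
to all means ψ * x, that is, to `J` (`le_actionKernel`).

Traces vanish off the radical as follows. Let t be outside the radical and let x be an extreme point
of `J`; some conjugate s of t moves x. Extend the trace to a state of `B(ℓ²(G))` and average it over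
G so that its restriction μ to `ℓ^∞(G)` satisfies μ * x = x; conjugation invariance keeps its values
on the trace's algebra. Extremality puts every Poisson transform F = P_x f in the multiplicative
domain of the state (`map_poisson_mul_self_of_mem_extremePoints`). As sx ≠ x, some F has different
means μ(F) and μ(L_s F), while covariance intertwines the two through λ(s). Evaluating in two ways
gives μ(F)φ(λ(s)) = μ(L_s F)φ(λ(s)), so φ(λ(s)) = 0 (`apply_smul_eq_zero`), and the trace kills
λ(t).

In the other direction, Day's almost invariant vectors supported on an amenable normal N have vector
states converging on G to the indicator of N, which is therefore the restriction of a trace. For N =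
R(G) this trace is 1 on the radical; for N trivial it is the canonical trace. Since traces are
determined by their values on G, uniqueness follows by comparing these. -/

/-! ### Bounded functions and means -/

/-- The Banach algebra `ℓ^∞(G)` of bounded real functions on `G`. -/
abbrev EllInfty (G : Type*) : Type _ := lp (fun _ : G => ℝ) ∞

namespace EllInfty

variable {G : Type*}

/-- A bounded function as an element of `ℓ^∞(G)`. -/
def ofBound (f : G → ℝ) (C : ℝ) (h : ∀ x, |f x| ≤ C) : EllInfty G :=
  ⟨f, memℓp_infty ⟨C, by rintro _ ⟨x, rfl⟩; exact h x⟩⟩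

@[simp] theorem ofBound_apply (f : G → ℝ) (C : ℝ) (h : ∀ x, |f x| ≤ C) (x : G) :
    ofBound f C h x = f x := rfl

theorem abs_apply_le (f : EllInfty G) (x : G) : |f x| ≤ ‖f‖ :=
  lp.norm_apply_le_norm (by simp) f x

theorem norm_le {f : EllInfty G} {C : ℝ} (hC : 0 ≤ C) (h : ∀ x, |f x| ≤ C) : ‖f‖ ≤ C :=
  lp.norm_le_of_forall_le hC h

/-- Left translation `(L_g f)(x) = f(g x)` on `ℓ^∞(G)`. -/
noncomputable def leftShift [Mul G] (g : G) : EllInfty G →ₗ[ℝ] EllInfty G where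
  toFun f := ofBound (fun x => f (g * x)) ‖f‖ fun _ => abs_apply_le f _
  map_add' _ _ := rfl
  map_smul' _ _ := rfl

@[simp] theorem leftShift_apply [Mul G] (g : G) (f : EllInfty G) (x : G) :
    leftShift g f x = f (g * x) := rfl

theorem leftShift_leftShift [Semigroup G] (g h : G) (f : EllInfty G) :
    leftShift h (leftShift g f) = leftShift (g * h) f := by
  ext x; simp [mul_assoc]

theorem leftShift_one [MulOneClass G] (f : EllInfty G) : leftShift 1 f = f := by
  ext x; simp

theorem leftShift_map_one [Mul G] (g : G) : leftShift g (1 : EllInfty G) = 1 := rfl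

theorem norm_leftShift_le [Mul G] (g : G) (f : EllInfty G) : ‖leftShift g f‖ ≤ ‖f‖ :=
  norm_le (norm_nonneg _) fun _ => abs_apply_le f _

/-- Positivity on ‖f‖·1 ± f gives the bound. Continuity is thus automatic, so purely algebraic means
live in the weak-star dual. -/
theorem abs_le_norm_of_nonneg {m : EllInfty G →ₗ[ℝ] ℝ}
    (hm : ∀ f : EllInfty G, (∀ x, 0 ≤ f x) → 0 ≤ m f) (h1 : m 1 = 1) (f : EllInfty G) :
    |m f| ≤ ‖f‖ := by
  have h₁ := hm (‖f‖ • 1 - f) fun x => by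
    have := le_of_abs_le (abs_apply_le f x)
    exact sub_nonneg.2 (by simpa using this)
  have h₂ := hm (‖f‖ • 1 + f) fun x => by
    have := neg_le_of_abs_le (abs_apply_le f x)
    have h : (‖f‖ • (1 : EllInfty G) + f) x = ‖f‖ * 1 + f x := rfl
    rw [h]; linarith
  simp only [map_sub, map_add, map_smul, h1, smul_eq_mul, mul_one] at h₁ h₂
  exact abs_le.2 ⟨by linarith, by linarith⟩

end EllInfty

open EllInfty

section Means

variable {G : Type*}

/-- The set of means on `ℓ^∞(G)`, in the weak-star dual of `ℓ^∞(G)`. -/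
def means (G : Type*) : Set (WeakDual ℝ (EllInfty G)) :=
  {m | (∀ f : EllInfty G, (∀ x, 0 ≤ f x) → 0 ≤ m f) ∧ m 1 = 1}

/-- A positive unital linear functional on `ℓ^∞(G)` as an element of the weak-star dual. -/
noncomputable def meanOfLinear (m : EllInfty G →ₗ[ℝ] ℝ)
    (hm : ∀ f : EllInfty G, (∀ x, 0 ≤ f x) → 0 ≤ m f) (h1 : m 1 = 1) :
    WeakDual ℝ (EllInfty G) :=
  StrongDual.toWeakDual (m.mkContinuous 1 fun f => by
    simpa using abs_le_norm_of_nonneg hm h1 f)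

@[simp] theorem meanOfLinear_apply (m : EllInfty G →ₗ[ℝ] ℝ)
    (hm : ∀ f : EllInfty G, (∀ x, 0 ≤ f x) → 0 ≤ m f) (h1 : m 1 = 1) (f : EllInfty G) :
    meanOfLinear m hm h1 f = m f := rfl

theorem meanOfLinear_mem (m : EllInfty G →ₗ[ℝ] ℝ)
    (hm : ∀ f : EllInfty G, (∀ x, 0 ≤ f x) → 0 ≤ m f) (h1 : m 1 = 1) :
    meanOfLinear m hm h1 ∈ means G := ⟨hm, h1⟩

theorem isClosed_means : IsClosed (means G) := by
  have : means G = (⋂ f : EllInfty G, ⋂ _ : ∀ x, 0 ≤ f x, {m | 0 ≤ m f}) ∩ {m | m 1 = 1} := by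
    ext m
    simp only [means, Set.mem_inter_iff, Set.mem_iInter, Set.mem_ofPred_eq]
  rw [this]
  refine IsClosed.inter (isClosed_iInter fun f => isClosed_iInter fun _ => ?_) ?_
  · exact isClosed_le continuous_const (WeakDual.eval_continuous f)
  · exact isClosed_eq (WeakDual.eval_continuous _) continuous_const

theorem abs_mean_le {m : WeakDual ℝ (EllInfty G)} (hm : m ∈ means G) (f : EllInfty G) :
    |m f| ≤ ‖f‖ :=
  abs_le_norm_of_nonneg (m := (WeakDual.toStrongDual m).toLinearMap) hm.1 hm.2 f

theorem isCompact_means : IsCompact (means G) := by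
  refine (WeakDual.isCompact_closedBall (𝕜 := ℝ) (E := EllInfty G) 0 1).of_isClosed_subset
    isClosed_means fun m hm => ?_
  simp only [Set.mem_preimage, Metric.mem_closedBall, dist_zero_right]
  exact ContinuousLinearMap.opNorm_le_bound _ zero_le_one fun f => by
    simpa using abs_mean_le hm f

theorem abs_apply_le_norm_mul (k : WeakDual ℝ (EllInfty G)) (f : EllInfty G) :
    |k f| ≤ ‖WeakDual.toStrongDual k‖ * ‖f‖ :=
  (WeakDual.toStrongDual k).le_opNorm f

/-- Evaluation at a point. -/
noncomputable def evalMean (g : G) : WeakDual ℝ (EllInfty G) :=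
  meanOfLinear ⟨⟨fun f => f g, fun _ _ => rfl⟩, fun _ _ => rfl⟩ (fun _ h => h g) rfl

theorem evalMean_mem (g : G) : evalMean g ∈ means G := meanOfLinear_mem _ _ _

/-- The mean `f ↦ μ(h f) / μ(h)`. -/
theorem exists_weighted_mean {μ : WeakDual ℝ (EllInfty G)} (hμ : μ ∈ means G) {h : EllInfty G}
    (hh : ∀ x, 0 ≤ h x) (hpos : 0 < μ h) :
    ∃ ψ ∈ means G, ∀ f, μ h * ψ f = μ (h * f) := by
  let ν : EllInfty G →ₗ[ℝ] ℝ :=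
    (μ h)⁻¹ • ((WeakDual.toStrongDual μ).toLinearMap ∘ₗ LinearMap.mulLeft ℝ h)
  have hν (f : EllInfty G) : ν f = (μ h)⁻¹ * μ (h * f) := rfl
  refine ⟨meanOfLinear ν (fun f hf => ?_) ?_, meanOfLinear_mem _ _ _, fun f => ?_⟩
  · rw [hν]
    exact mul_nonneg (inv_nonneg.2 hpos.le) (hμ.1 _ fun x => mul_nonneg (hh x) (hf x))
  · rw [hν, mul_one, inv_mul_cancel₀ hpos.ne']
  · rw [meanOfLinear_apply, hν, mul_inv_cancel_left₀ hpos.ne']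

variable [Group G]

theorem abs_apply_leftShift_le (k : WeakDual ℝ (EllInfty G)) (g : G) (f : EllInfty G) :
    |k (leftShift g f)| ≤ ‖WeakDual.toStrongDual k‖ * ‖f‖ :=
  (abs_apply_le_norm_mul k _).trans
    (mul_le_mul_of_nonneg_left (norm_leftShift_le g f) (norm_nonneg _))

/-! ### Poisson transforms and the Arens semigroup -/

/-- The Poisson transform `(P_k f)(g) = k(L_g f)`. -/
noncomputable def poisson (k : WeakDual ℝ (EllInfty G)) : EllInfty G →L[ℝ] EllInfty G :=
  LinearMap.mkContinuous
    { toFun := fun f => ofBound (fun g => k (leftShift g f)) (‖WeakDual.toStrongDual k‖ * ‖f‖)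
        fun g => abs_apply_leftShift_le k g f
      map_add' := fun f₁ f₂ => by
        ext g
        change k (leftShift g (f₁ + f₂)) = k (leftShift g f₁) + k (leftShift g f₂)
        rw [map_add, map_add]
      map_smul' := fun c f => by
        ext g
        change k (leftShift g (c • f)) = c • k (leftShift g f)
        rw [map_smul, map_smul] }
    ‖WeakDual.toStrongDual k‖ fun f => norm_le (by positivity) fun g =>
      abs_apply_leftShift_le k g f

@[simp] theorem poisson_apply (k : WeakDual ℝ (EllInfty G)) (f : EllInfty G) (g : G) :
    poisson k f g = k (leftShift g f) := rfl

theorem poisson_leftShift (k : WeakDual ℝ (EllInfty G)) (g : G) (f : EllInfty G) :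
    poisson k (leftShift g f) = leftShift g (poisson k f) := by
  ext h; simp [leftShift_leftShift]

/-- The Arens product on the dual of `ℓ^∞(G)`. -/
noncomputable def arens (ψ k : WeakDual ℝ (EllInfty G)) : WeakDual ℝ (EllInfty G) :=
  StrongDual.toWeakDual ((WeakDual.toStrongDual ψ).comp (poisson k))

@[simp] theorem arens_apply (ψ k : WeakDual ℝ (EllInfty G)) (f : EllInfty G) :
    arens ψ k f = ψ (poisson k f) := rfl

theorem poisson_arens (ψ k : WeakDual ℝ (EllInfty G)) (f : EllInfty G) :
    poisson (arens ψ k) f = poisson ψ (poisson k f) := by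
  ext g; simp [poisson_leftShift]

theorem arens_assoc (ψ φ k : WeakDual ℝ (EllInfty G)) :
    arens (arens ψ φ) k = arens ψ (arens φ k) := by
  refine DFunLike.ext _ _ fun f => ?_
  simp [poisson_arens]

theorem arens_mem {ψ k : WeakDual ℝ (EllInfty G)} (hψ : ψ ∈ means G) (hk : k ∈ means G) :
    arens ψ k ∈ means G := by
  refine ⟨fun f hf => hψ.1 _ fun g => hk.1 _ fun x => hf _, ?_⟩
  have : poisson k 1 = 1 := by
    ext g
    simp [leftShift_map_one, hk.2]
  rw [arens_apply, this, hψ.2]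

/-- One-sided continuity suffices: it makes the principal left ideal generated by k, an image of the
compact set of means, closed. -/
theorem continuous_arens_left (k : WeakDual ℝ (EllInfty G)) : Continuous fun ψ => arens ψ k :=
  WeakDual.continuous_of_continuous_eval fun f => WeakDual.eval_continuous (poisson k f)

theorem arens_evalMean_apply (t : G) (k : WeakDual ℝ (EllInfty G)) (f : EllInfty G) :
    arens (evalMean t) k f = k (leftShift t f) := rfl

theorem arens_evalMean_one (k : WeakDual ℝ (EllInfty G)) : arens (evalMean 1) k = k := by
  refine DFunLike.ext _ _ fun f => ?_
  rw [arens_evalMean_apply, leftShift_one]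

theorem arens_evalMean_mul (s t : G) (k : WeakDual ℝ (EllInfty G)) :
    arens (evalMean s) (arens (evalMean t) k) = arens (evalMean (s * t)) k := by
  refine DFunLike.ext _ _ fun f => ?_
  rw [arens_evalMean_apply, arens_evalMean_apply, arens_evalMean_apply, leftShift_leftShift]

/-! ### Minimal left ideals and the amenable radical -/

/-- Nonempty closed left ideals of the semigroup of means. -/
def IsClosedLeftIdeal (J : Set (WeakDual ℝ (EllInfty G))) : Prop :=
  J.Nonempty ∧ IsClosed J ∧ J ⊆ means G ∧ ∀ ψ ∈ means G, ∀ k ∈ J, arens ψ k ∈ J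

/-- Zorn's lemma; compactness of the means keeps intersections of chains nonempty. -/
theorem exists_minimal_closedLeftIdeal (G : Type*) [Group G] :
    ∃ J : Set (WeakDual ℝ (EllInfty G)), Minimal IsClosedLeftIdeal J := by
  have hM : IsClosedLeftIdeal (means G) :=
    ⟨⟨_, evalMean_mem 1⟩, isClosed_means, subset_rfl, fun _ h _ => arens_mem h⟩
  have hchains : ∀ c ⊆ {J | IsClosedLeftIdeal (G := G) J}, IsChain (· ⊆ ·) c → c.Nonempty →
      ∃ I ∈ {J | IsClosedLeftIdeal (G := G) J}, ∀ s ∈ c, I ⊆ s := by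
    intro c hc hchain hne
    refine ⟨⋂₀ c, ⟨?_, isClosed_sInter fun J hJ => (hc hJ).2.1, ?_, ?_⟩,
      fun J hJ => Set.sInter_subset_of_mem hJ⟩
    · have : Nonempty c := hne.to_subtype
      refine IsCompact.nonempty_sInter_of_directed_nonempty_isCompact_isClosed
        (fun a ha b hb => ?_) ?_ ?_ ?_
      · rcases hchain.total ha hb with h | h
        · exact ⟨a, ha, subset_rfl, h⟩
        · exact ⟨b, hb, h, subset_rfl⟩
      · exact fun J hJ => (hc hJ).1
      · exact fun J hJ => isCompact_means.of_isClosed_subset (hc hJ).2.1 (hc hJ).2.2.1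
      · exact fun J hJ => (hc hJ).2.1
    · obtain ⟨J, hJ⟩ := hne
      exact (Set.sInter_subset_of_mem hJ).trans (hc hJ).2.2.1
    · exact fun ψ hψ k hk J hJ => (hc hJ).2.2.2 ψ hψ k (hk J hJ)
  obtain ⟨J, -, hJ⟩ := zorn_superset_nonempty _ hchains (means G) hM
  exact ⟨J, hJ⟩

/-- A left ideal `S k` in a minimal closed left ideal `J` exhausts `J`. -/
theorem exists_arens_eq_of_minimal {J : Set (WeakDual ℝ (EllInfty G))}
    (hJ : Minimal IsClosedLeftIdeal J) {k x : WeakDual ℝ (EllInfty G)} (hk : k ∈ J) (hx : x ∈ J) :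
    ∃ ψ ∈ means G, arens ψ k = x := by
  have hI : IsClosedLeftIdeal ((fun ψ => arens ψ k) '' means G) := by
    refine ⟨⟨_, _, evalMean_mem 1, rfl⟩, ?_, ?_, ?_⟩
    · exact (isCompact_means.image (continuous_arens_left k)).isClosed
    · rintro _ ⟨ψ, hψ, rfl⟩
      exact arens_mem hψ (hJ.prop.2.2.1 hk)
    · rintro ψ hψ _ ⟨φ, hφ, rfl⟩
      exact ⟨_, arens_mem hψ hφ, arens_assoc _ _ _⟩
  have := hJ.le_of_le hI (by rintro _ ⟨ψ, hψ, rfl⟩; exact hJ.prop.2.2.2 ψ hψ k hk)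
  exact this hx

/-- The kernel of the action of `G` on a left ideal of means. -/
def actionKernel {J : Set (WeakDual ℝ (EllInfty G))} (_hJ : IsClosedLeftIdeal J) : Subgroup G where
  carrier := {t | ∀ k ∈ J, arens (evalMean t) k = k}
  one_mem' k _ := arens_evalMean_one k
  mul_mem' {s t} hs ht k hk := by rw [← arens_evalMean_mul, ht k hk, hs k hk]
  inv_mem' {t} ht k hk := by
    nth_rewrite 1 [← ht k hk]
    rw [arens_evalMean_mul, inv_mul_cancel, arens_evalMean_one]

theorem actionKernel_normal {J : Set (WeakDual ℝ (EllInfty G))} (hJ : IsClosedLeftIdeal J) :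
    (actionKernel hJ).Normal := by
  refine ⟨fun t ht g k hk => ?_⟩
  rw [← arens_evalMean_mul, ← arens_evalMean_mul,
    ht _ (hJ.2.2.2 _ (evalMean_mem g⁻¹) k hk), arens_evalMean_mul, mul_inv_cancel,
    arens_evalMean_one]

/-- A normal subgroup fixing a mean on `ℓ^∞(G)` is amenable. -/
theorem isAmenableGroup_of_invariant_mean (N : Subgroup G) [N.Normal]
    {k : WeakDual ℝ (EllInfty G)} (hk : k ∈ means G)
    (hN : ∀ t ∈ N, arens (evalMean t) k = k) : IsAmenableGroup N := by
  -- Coset representatives give an N-equivariant map π : G → N, along which the mean is pushed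
  -- forward.
  have hmem (g : G) : g * (g : G ⧸ N).out⁻¹ ∈ N := by
    rw [← QuotientGroup.eq_one_iff]
    simp
  let π : G → N := fun g => ⟨g * (g : G ⧸ N).out⁻¹, hmem g⟩
  have hπ (s : N) (g : G) : π (s * g) = s * π g := by
    have : ((s * g : G) : G ⧸ N) = (g : G ⧸ N) := by
      rw [QuotientGroup.mk_mul, (QuotientGroup.eq_one_iff (s : G)).2 s.2, one_mul]
    ext
    simp only [π, Subgroup.coe_mul, this, mul_assoc]
  let pull : EllInfty N →ₗ[ℝ] EllInfty G :=
    { toFun := fun f => ofBound (fun g => f (π g)) ‖f‖ fun _ => abs_apply_le f _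
      map_add' := fun _ _ => rfl
      map_smul' := fun _ _ => rfl }
  refine ⟨(WeakDual.toStrongDual k).toLinearMap ∘ₗ pull, fun f hf => hk.1 _ fun g => hf _,
    hk.2, fun s f g hfg => ?_⟩
  have : pull g = leftShift (s : G) (pull f) := by
    ext x
    change g (π x) = f (π (s * x))
    rw [hfg, hπ]
  change k (pull g) = k (pull f)
  rw [this, ← arens_evalMean_apply, hN s s.2]

/-- Each translate is fixed, since t·(g·x) = g·((g⁻¹tg)·x) = g·x; averaging over ψ preserves this.
-/
theorem arens_evalMean_arens_of_conj {t : G} {x : WeakDual ℝ (EllInfty G)}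
    (h : ∀ g : G, arens (evalMean (g⁻¹ * t * g)) x = x) (ψ : WeakDual ℝ (EllInfty G)) :
    arens (evalMean t) (arens ψ x) = arens ψ x := by
  refine DFunLike.ext _ _ fun f => ?_
  rw [arens_evalMean_apply, arens_apply, arens_apply]
  congr 1
  ext g
  rw [poisson_apply, poisson_apply, leftShift_leftShift,
    ← DFunLike.congr_fun (h g) (leftShift g f), arens_evalMean_apply, leftShift_leftShift]
  congr 2
  group

/-- Every amenable normal subgroup acts trivially on a minimal closed left ideal of means. -/
theorem le_actionKernel {J : Set (WeakDual ℝ (EllInfty G))} (hJ : Minimal IsClosedLeftIdeal J)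
    {M : Subgroup G} (hM : M.Normal) (hA : IsAmenableGroup M) : M ≤ actionKernel hJ.prop := by
  obtain ⟨m, hm, hm1, hinv⟩ := hA
  let res : EllInfty G →ₗ[ℝ] EllInfty M :=
    { toFun := fun f => ofBound (fun x => f x) ‖f‖ fun _ => abs_apply_le f _
      map_add' := fun _ _ => rfl
      map_smul' := fun _ _ => rfl }
  let ψ : WeakDual ℝ (EllInfty G) :=
    meanOfLinear (m ∘ₗ res) (fun f hf => hm _ fun x => hf _) hm1
  have hψ : ψ ∈ means G := meanOfLinear_mem _ _ _
  have hfix (s : G) (hs : s ∈ M) (f : EllInfty G) : ψ (leftShift s f) = ψ f :=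
    hinv ⟨s, hs⟩ (res f) (res (leftShift s f)) fun _ => rfl
  obtain ⟨k, hk⟩ := hJ.prop.1
  set x := arens ψ k with hx
  have hxJ : x ∈ J := hJ.prop.2.2.2 ψ hψ k hk
  have hxfix (s : G) (hs : s ∈ M) : arens (evalMean s) x = x := by
    refine DFunLike.ext _ _ fun f => ?_
    rw [arens_evalMean_apply, hx, arens_apply, arens_apply, poisson_leftShift, hfix s hs]
  intro s hs y hy
  obtain ⟨φ, -, rfl⟩ := exists_arens_eq_of_minimal hJ hxJ hy
  exact arens_evalMean_arens_of_conj
    (fun g => hxfix _ (by simpa using hM.conj_mem s hs g⁻¹)) φ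

theorem isGreatest_actionKernel {J : Set (WeakDual ℝ (EllInfty G))}
    (hJ : Minimal IsClosedLeftIdeal J) :
    IsGreatest {N : Subgroup G | N.Normal ∧ IsAmenableGroup N} (actionKernel hJ.prop) := by
  have := actionKernel_normal hJ.prop
  obtain ⟨k, hk⟩ := hJ.prop.1
  exact ⟨⟨this, isAmenableGroup_of_invariant_mean _ (hJ.prop.2.2.1 hk) fun t ht => ht k hk⟩,
    fun M hM => le_actionKernel hJ hM.1 hM.2⟩

theorem actionKernel_eq_amenableRadical {J : Set (WeakDual ℝ (EllInfty G))}
    (hJ : Minimal IsClosedLeftIdeal J) : actionKernel hJ.prop = amenableRadical G :=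
  (isGreatest_actionKernel hJ).isLUB.sSup_eq.symm

/-! ### Extreme points and multiplicative domains -/

instance weakDual_locallyConvexSpace : LocallyConvexSpace ℝ (WeakDual ℝ (EllInfty G)) :=
  inferInstanceAs (LocallyConvexSpace ℝ (WeakBilin (topDualPairing ℝ (EllInfty G))))

/-- If `μ * k` is an extreme point of the left ideal `J`, then Poisson transforms with respect to
`k` lie in the multiplicative domain of `μ`. -/
theorem map_poisson_mul_self_of_mem_extremePoints {J : Set (WeakDual ℝ (EllInfty G))}
    (hJ : IsClosedLeftIdeal J) {k μ : WeakDual ℝ (EllInfty G)} (hk : k ∈ J) (hμ : μ ∈ means G)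
    (hx : arens μ k ∈ J.extremePoints ℝ) (f : EllInfty G) :
    μ (poisson k f * poisson k f) = μ (poisson k f) ^ 2 := by
  set F := poisson k f with hF
  set R := ‖F‖ + 1 with hR
  have hR0 : 0 < R := by positivity
  have hFabs (x : G) : |F x| ≤ ‖F‖ := abs_apply_le F x
  have hc : |μ F| ≤ ‖F‖ := abs_mean_le hμ F
  -- An affine rescaling of F; taking R = ‖F‖ + 1 keeps h strictly between 0 and 1. The weights h
  -- and 1 - h split μ into a proper convex combination, so extremality gives μ(hF) = μ(h)μ(F),
  -- which is the claim up to scaling.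
  set h : EllInfty G := (2 * R)⁻¹ • (F + R • 1) with hh
  have hhx (x : G) : h x = (2 * R)⁻¹ * (F x + R * 1) := rfl
  have hμh : μ h = (2 * R)⁻¹ * (μ F + R) := by
    rw [hh, map_smul, map_add, map_smul, hμ.2, smul_eq_mul, smul_eq_mul, mul_one]
  have hμ1 : μ (1 - h) = 1 - μ h := by rw [map_sub, hμ.2]
  have hpos : 0 < μ h := by
    rw [hμh]
    exact mul_pos (by positivity) (by linarith [neg_le_of_abs_le hc])
  have hlt : 0 < μ (1 - h) := by
    have : (2 * R)⁻¹ * (μ F + R) < (2 * R)⁻¹ * (2 * R) :=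
      mul_lt_mul_of_pos_left (by linarith [le_of_abs_le hc]) (by positivity)
    rw [inv_mul_cancel₀ (by positivity)] at this
    rw [hμ1, hμh]; linarith
  obtain ⟨ψ₁, hψ₁, h₁⟩ := exists_weighted_mean hμ (h := h) (fun x => by
    rw [hhx]
    exact mul_nonneg (by positivity) (by linarith [neg_le_of_abs_le (hFabs x)])) hpos
  obtain ⟨ψ₂, hψ₂, h₂⟩ := exists_weighted_mean hμ (h := 1 - h) (fun x => by
    have : (2 * R)⁻¹ * (F x + R * 1) ≤ (2 * R)⁻¹ * (2 * R) :=
      mul_le_mul_of_nonneg_left (by linarith [le_of_abs_le (hFabs x)]) (by positivity)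
    rw [inv_mul_cancel₀ (by positivity), ← hhx] at this
    exact sub_nonneg.2 this) hlt
  have hseg : arens μ k ∈ openSegment ℝ (arens ψ₁ k) (arens ψ₂ k) := by
    refine ⟨μ h, μ (1 - h), hpos, hlt, by rw [hμ1]; ring, DFunLike.ext _ _ fun e => ?_⟩
    change μ h * ψ₁ (poisson k e) + μ (1 - h) * ψ₂ (poisson k e) = μ (poisson k e)
    rw [h₁, h₂, ← map_add, ← add_mul, add_sub_cancel, one_mul]
  have heq : arens ψ₁ k = arens μ k :=
    ((mem_extremePoints.1 hx).2 _ (hJ.2.2.2 _ hψ₁ k hk) _ (hJ.2.2.2 _ hψ₂ k hk) hseg).1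
  have hval : ψ₁ F = μ F := DFunLike.congr_fun heq f
  have h3 := h₁ F
  rw [hval, hμh] at h3
  have h4 : h * F = (2 * R)⁻¹ • (F * F + R • F) := by
    rw [hh, smul_mul_assoc, add_mul, smul_mul_assoc, one_mul]
  rw [h4, map_smul, map_add, map_smul, smul_eq_mul, smul_eq_mul, mul_assoc] at h3
  have h5 := mul_left_cancel₀ (by positivity) h3
  linarith

end Means

/-! ### Real states on bounded operators -/

section States

variable {H : Type*} [NormedAddCommGroup H] [InnerProductSpace ℂ H]

/-- The real part of a state on `B(H)`: a real-linear functional which is unital, and nonnegative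
on all operators with nonnegative real part. -/
structure IsRealState (φ : (H →L[ℂ] H) →ₗ[ℝ] ℝ) : Prop where
  nonneg : ∀ T : H →L[ℂ] H, (∀ ξ, 0 ≤ T.reApplyInnerSelf ξ) → 0 ≤ φ T
  map_one : φ 1 = 1

theorem reApplyInnerSelf_add (S T : H →L[ℂ] H) (ξ : H) :
    (S + T).reApplyInnerSelf ξ = S.reApplyInnerSelf ξ + T.reApplyInnerSelf ξ := by
  simp [ContinuousLinearMap.reApplyInnerSelf_apply, inner_add_left]

theorem reApplyInnerSelf_real_smul (c : ℝ) (T : H →L[ℂ] H) (ξ : H) :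
    (c • T).reApplyInnerSelf ξ = c * T.reApplyInnerSelf ξ := by
  simp [ContinuousLinearMap.reApplyInnerSelf_apply]

theorem reApplyInnerSelf_neg (T : H →L[ℂ] H) (ξ : H) :
    (-T).reApplyInnerSelf ξ = -T.reApplyInnerSelf ξ := by
  simp [ContinuousLinearMap.reApplyInnerSelf_apply]

theorem abs_reApplyInnerSelf_le (T : H →L[ℂ] H) (ξ : H) :
    |T.reApplyInnerSelf ξ| ≤ ‖T‖ * ‖ξ‖ ^ 2 := by
  rw [ContinuousLinearMap.reApplyInnerSelf_apply]
  calc |RCLike.re (inner ℂ (T ξ) ξ)| ≤ ‖T ξ‖ * ‖ξ‖ :=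
        (RCLike.abs_re_le_norm _).trans (norm_inner_le_norm _ _)
    _ ≤ ‖T‖ * ‖ξ‖ * ‖ξ‖ := by gcongr; exact T.le_opNorm ξ
    _ = ‖T‖ * ‖ξ‖ ^ 2 := by ring

theorem reApplyInnerSelf_one (ξ : H) : (1 : H →L[ℂ] H).reApplyInnerSelf ξ = ‖ξ‖ ^ 2 := by
  rw [ContinuousLinearMap.reApplyInnerSelf_apply]
  exact inner_self_eq_norm_sq ξ

theorem reApplyInnerSelf_norm_smul_one_add_nonneg (T : H →L[ℂ] H) (ξ : H) :
    0 ≤ (‖T‖ • (1 : H →L[ℂ] H) + T).reApplyInnerSelf ξ := by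
  rw [reApplyInnerSelf_add, reApplyInnerSelf_real_smul, reApplyInnerSelf_one]
  linarith [neg_le_of_abs_le (abs_reApplyInnerSelf_le T ξ)]

theorem IsRealState.abs_le {φ : (H →L[ℂ] H) →ₗ[ℝ] ℝ} (hφ : IsRealState φ) (T : H →L[ℂ] H) :
    |φ T| ≤ ‖T‖ := by
  have key (S : H →L[ℂ] H) : -‖S‖ ≤ φ S := by
    have := hφ.nonneg _ (reApplyInnerSelf_norm_smul_one_add_nonneg S)
    rw [map_add, map_smul, hφ.map_one, smul_eq_mul, mul_one] at this
    linarith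
  refine _root_.abs_le.2 ⟨key T, ?_⟩
  have := key (-T)
  rw [map_neg, norm_neg] at this
  linarith

variable [CompleteSpace H]

theorem reApplyInnerSelf_star (T : H →L[ℂ] H) (ξ : H) :
    (star T).reApplyInnerSelf ξ = T.reApplyInnerSelf ξ := by
  rw [ContinuousLinearMap.reApplyInnerSelf_apply, ContinuousLinearMap.reApplyInnerSelf_apply,
    ContinuousLinearMap.star_eq_adjoint, ContinuousLinearMap.adjoint_inner_left,
    ← inner_conj_symm, RCLike.conj_re]

theorem reApplyInnerSelf_star_mul_self (T : H →L[ℂ] H) (ξ : H) :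
    (star T * T).reApplyInnerSelf ξ = ‖T ξ‖ ^ 2 := by
  rw [ContinuousLinearMap.reApplyInnerSelf_apply, mul_apply_eq_comp,
    ContinuousLinearMap.star_eq_adjoint, ContinuousLinearMap.adjoint_inner_left]
  exact inner_self_eq_norm_sq _

namespace IsRealState

variable {φ : (H →L[ℂ] H) →ₗ[ℝ] ℝ}

theorem map_star (hφ : IsRealState φ) (T : H →L[ℂ] H) : φ (star T) = φ T := by
  have key (S : H →L[ℂ] H) : φ (star S) ≤ φ S := by
    have := hφ.nonneg (S + -star S) fun ξ => by
      rw [reApplyInnerSelf_add, reApplyInnerSelf_neg, reApplyInnerSelf_star, add_neg_cancel]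
    rw [map_add, map_neg] at this
    linarith
  refine le_antisymm (key T) ?_
  simpa using key (star T)

theorem star_mul_self_nonneg (hφ : IsRealState φ) (T : H →L[ℂ] H) : 0 ≤ φ (star T * T) :=
  hφ.nonneg _ fun ξ => by rw [reApplyInnerSelf_star_mul_self]; positivity

/-- The degenerate case of Cauchy–Schwarz: positivity on T* + rS leaves an expression affine in r,
so its slope 2φ(TS) must vanish. -/
theorem map_mul_eq_zero (hφ : IsRealState φ) {S : H →L[ℂ] H} (hS : φ (star S * S) = 0)
    (T : H →L[ℂ] H) : φ (T * S) = 0 := by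
  have key (r : ℝ) : 0 ≤ φ (T * star T) + 2 * r * φ (T * S) := by
    have h := hφ.star_mul_self_nonneg (star T + r • S)
    have hexp : star (star T + r • S) * (star T + r • S) =
        T * star T + r • (T * S) + r • star (T * S) + (r * r) • (star S * S) := by
      simp only [star_add, star_star, star_smul, star_mul, add_mul, mul_add, star_trivial,
        smul_mul_assoc, mul_smul_comm, smul_smul, smul_add]
      abel
    rw [hexp, map_add, map_add, map_add, map_smul, map_smul, map_smul, hS, hφ.map_star] at h
    simp only [smul_eq_mul] at h
    linarith
  by_contra hne
  -- This r makes the affine expression equal to -1.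
  have := key (-(φ (T * star T) + 1) / (2 * φ (T * S)))
  have h2 : 2 * (-(φ (T * star T) + 1) / (2 * φ (T * S))) * φ (T * S) =
      -(φ (T * star T) + 1) := by
    field_simp
  linarith

theorem map_mul_eq_zero_of_isSelfAdjoint (hφ : IsRealState φ) {S : H →L[ℂ] H}
    (hsa : IsSelfAdjoint S) (hS : φ (S * S) = 0) (T : H →L[ℂ] H) : φ (S * T) = 0 := by
  rw [← hφ.map_star, star_mul, hsa.star_eq]
  exact hφ.map_mul_eq_zero (by rwa [hsa.star_eq]) _

end IsRealState

/-- A positive functional on a star-algebra is hermitian. -/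
theorem map_star_eq_conj_of_nonneg {A : Type*} [Ring A] [StarRing A] [Algebra ℂ A]
    [StarModule ℂ A] {τ : A →ₗ[ℂ] ℂ} (hτ : ∀ a : A, 0 ≤ τ (star a * a)) (a : A) :
    τ (star a) = star (τ a) := by
  -- Polarization: reality at 1 + a and at 1 + ia controls the imaginary and real parts of τ(a*)
  -- respectively.
  have im0 (b : A) : (τ (star b * b)).im = 0 := (Complex.nonneg_iff.1 (hτ b)).2.symm
  have h1 := im0 (1 + a)
  have h2 := im0 (1 + Complex.I • a)
  have h3 := im0 a
  have h4 := im0 1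
  have e1 : star (1 + a) * (1 + a) = star 1 * 1 + a + star a + star a * a := by
    simp only [star_add, star_one, add_mul, mul_add, one_mul, mul_one]; abel
  have e2 : star (1 + Complex.I • a) * (1 + Complex.I • a) =
      star 1 * 1 + Complex.I • a - Complex.I • star a + star a * a := by
    have hI : star (Complex.I • a) = -(Complex.I • star a) := by
      rw [star_smul, Complex.star_def, Complex.conj_I, neg_smul]
    have hII : (Complex.I • star a) * (Complex.I • a) = -(star a * a) := by
      rw [mul_smul_comm, smul_mul_assoc, smul_smul, Complex.I_mul_I, neg_one_smul]
    rw [star_add, hI, add_mul, mul_add, mul_add, star_one, one_mul, one_mul, mul_one, neg_mul, hII]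
    abel
  rw [e1] at h1
  rw [e2] at h2
  simp only [map_add, map_sub, map_smul, Complex.add_im, Complex.sub_im, smul_eq_mul,
    Complex.mul_im, Complex.I_re, Complex.I_im, zero_mul, one_mul, zero_add] at h1 h2
  apply Complex.ext
  · rw [Complex.star_def, Complex.conj_re]; linarith
  · rw [Complex.star_def, Complex.conj_im]; linarith

/-- In a closed star-subalgebra, an element with nonnegative real part satisfies
`a + a* = b* b` with `b` in the subalgebra. -/
theorem exists_add_star_eq_star_mul_self (A : StarSubalgebra ℂ (H →L[ℂ] H))
    (hA : IsClosed (A : Set (H →L[ℂ] H))) (a : A)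
    (ha : ∀ ξ, 0 ≤ (a : H →L[ℂ] H).reApplyInnerSelf ξ) :
    ∃ b : A, a + star a = star b * b := by
  set T : H →L[ℂ] H := a + star (a : H →L[ℂ] H) with hT
  have hsa : IsSelfAdjoint T := IsSelfAdjoint.add_star_self _
  have hpos : 0 ≤ T := by
    rw [ContinuousLinearMap.nonneg_iff_isPositive, ContinuousLinearMap.isPositive_def]
    refine ⟨ContinuousLinearMap.isSelfAdjoint_iff_isSymmetric.1 hsa, fun ξ => ?_⟩
    rw [hT, reApplyInnerSelf_add, reApplyInnerSelf_star]
    exact add_nonneg (ha ξ) (ha ξ)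
  have hTA : T ∈ A := add_mem a.2 (star_mem a.2)
  -- Closedness of `A` keeps the functional calculus of T inside `A`.
  have hmem : CFC.sqrt T ∈ A := by
    rw [CFC.sqrt_eq_real_sqrt T hpos, cfcₙ_eq_cfc]
    exact cfc_mem (𝕜' := ℂ) (hs := hA) _ hTA
  refine ⟨⟨CFC.sqrt T, hmem⟩, Subtype.ext ?_⟩
  change T = star (CFC.sqrt T) * CFC.sqrt T
  rw [(IsSelfAdjoint.of_nonneg (CFC.sqrt_nonneg T)).star_eq, CFC.sqrt_mul_sqrt_self T hpos]

/-- A state on a closed star-subalgebra of `B(H)` extends to `B(H)`. -/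
theorem exists_isRealState_extension (A : StarSubalgebra ℂ (H →L[ℂ] H))
    (hA : IsClosed (A : Set (H →L[ℂ] H))) (τ : A →ₗ[ℂ] ℂ)
    (hτ : ∀ a : A, 0 ≤ τ (star a * a)) (h1 : τ 1 = 1) :
    ∃ φ : (H →L[ℂ] H) →ₗ[ℝ] ℝ, IsRealState φ ∧ ∀ a : A, φ a = (τ a).re := by
  let C : PointedCone ℝ (H →L[ℂ] H) :=
    { carrier := {T | ∀ ξ, 0 ≤ T.reApplyInnerSelf ξ}
      zero_mem' := fun ξ => by simp [ContinuousLinearMap.reApplyInnerSelf_apply]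
      add_mem' := fun hS hT ξ => by
        rw [reApplyInnerSelf_add]; exact add_nonneg (hS ξ) (hT ξ)
      smul_mem' := fun c T hT ξ => by
        change 0 ≤ ((c : ℝ) • T).reApplyInnerSelf ξ
        rw [reApplyInnerSelf_real_smul]; exact mul_nonneg c.2 (hT ξ) }
  let f : (H →L[ℂ] H) →ₗ.[ℝ] ℝ :=
    { domain := A.toSubalgebra.toSubmodule.restrictScalars ℝ
      toFun :=
        { toFun := fun a => (τ ⟨a.1, a.2⟩).re
          map_add' := fun a b => by
            change (τ (⟨a.1, a.2⟩ + ⟨b.1, b.2⟩ : A)).re = _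
            rw [map_add, Complex.add_re]
          map_smul' := fun c a => by
            change (τ ((c : ℂ) • ⟨a.1, a.2⟩ : A)).re = _
            rw [map_smul, smul_eq_mul, Complex.re_ofReal_mul]; rfl } }
  -- Positivity in `B(H)` has to be recognized inside `A`: a + a* = b*b there, and 2 Re τ(a) =
  -- τ(b*b).
  have hf : ∀ a : f.domain, (a : H →L[ℂ] H) ∈ C → 0 ≤ f a := by
    intro a ha
    obtain ⟨b, hb⟩ := exists_add_star_eq_star_mul_self A hA ⟨a.1, a.2⟩ ha
    have h := (Complex.nonneg_iff.1 (hτ b)).1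
    rw [← hb, map_add, map_star_eq_conj_of_nonneg hτ, Complex.add_re, Complex.star_def,
      Complex.conj_re] at h
    change 0 ≤ (τ ⟨a.1, a.2⟩).re
    linarith
  have hdense : ∀ T, ∃ a : f.domain, (a : H →L[ℂ] H) + T ∈ C := fun T =>
    ⟨⟨‖T‖ • 1, (A.toSubalgebra.toSubmodule.restrictScalars ℝ).smul_mem _ A.one_mem⟩,
      reApplyInnerSelf_norm_smul_one_add_nonneg T⟩
  obtain ⟨φ, hφ, hpos⟩ := riesz_extension C f hf hdense
  have hφA (a : A) : φ a = (τ a).re := hφ ⟨a.1, a.2⟩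
  refine ⟨φ, ⟨hpos, ?_⟩, hφA⟩
  have := hφA 1
  rwa [h1] at this

end States

/-! ### Covariant representations and averaging of states -/

/-- A covariant representation of `ℓ^∞(G)` and `G` on a Hilbert space. -/
structure IsCovariantRep {G H : Type*} [Group G] [NormedAddCommGroup H] [InnerProductSpace ℂ H]
    [CompleteSpace H] (u : G →* (H →L[ℂ] H)) (M : EllInfty G →ₗ[ℝ] (H →L[ℂ] H)) : Prop where
  star_map : ∀ g, star (u g) = u g⁻¹
  map_one : M 1 = 1
  map_mul : ∀ f₁ f₂, M (f₁ * f₂) = M f₁ * M f₂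
  isSelfAdjoint : ∀ f, IsSelfAdjoint (M f)
  nonneg : ∀ f : EllInfty G, (∀ x, 0 ≤ f x) → ∀ ξ, 0 ≤ (M f).reApplyInnerSelf ξ
  covariant : ∀ t f, u t * M f = M (leftShift t⁻¹ f) * u t

namespace IsCovariantRep

variable {G H : Type*} [Group G] [NormedAddCommGroup H] [InnerProductSpace ℂ H] [CompleteSpace H]
  {u : G →* (H →L[ℂ] H)} {M : EllInfty G →ₗ[ℝ] (H →L[ℂ] H)} {φ : (H →L[ℂ] H) →ₗ[ℝ] ℝ}

/-- The mean obtained by restricting a state of `B(H)` to `ℓ^∞(G)`. -/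
noncomputable def restrictMean (hM : IsCovariantRep u M) (hφ : IsRealState φ) :
    WeakDual ℝ (EllInfty G) :=
  meanOfLinear (φ ∘ₗ M) (fun f hf => hφ.nonneg _ (hM.nonneg f hf))
    (by rw [LinearMap.comp_apply, hM.map_one, hφ.map_one])

@[simp] theorem restrictMean_apply (hM : IsCovariantRep u M) (hφ : IsRealState φ)
    (f : EllInfty G) : hM.restrictMean hφ f = φ (M f) := rfl

theorem restrictMean_mem (hM : IsCovariantRep u M) (hφ : IsRealState φ) :
    hM.restrictMean hφ ∈ means G := meanOfLinear_mem _ _ _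

variable {f : EllInfty G}

theorem map_sub_smul_one (hM : IsCovariantRep u M) (f : EllInfty G) (c : ℝ) :
    M (f - c • 1) = M f - c • 1 := by
  rw [map_sub, map_smul, hM.map_one]

/-- Zero variance: this is the input for Cauchy–Schwarz, which makes φ multiplicative against `M f`
on either side. -/
theorem apply_sub_sq (hM : IsCovariantRep u M) (hφ : IsRealState φ)
    (hf : φ (M (f * f)) = φ (M f) ^ 2) :
    φ (M (f - φ (M f) • 1) * M (f - φ (M f) • 1)) = 0 := by
  have : (f - φ (M f) • 1) * (f - φ (M f) • 1) =
      f * f - φ (M f) • f - φ (M f) • f + (φ (M f) * φ (M f)) • (1 : EllInfty G) := by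
    ext x
    change (f x - φ (M f) * 1) * (f x - φ (M f) * 1) =
      f x * f x - φ (M f) * f x - φ (M f) * f x + (φ (M f) * φ (M f)) * 1
    ring
  rw [← hM.map_mul, this]
  simp only [map_add, map_sub, map_smul, hM.map_one, hφ.map_one, hf, smul_eq_mul]
  ring

theorem apply_mul_map (hM : IsCovariantRep u M) (hφ : IsRealState φ)
    (hf : φ (M (f * f)) = φ (M f) ^ 2) (T : H →L[ℂ] H) : φ (T * M f) = φ (M f) * φ T := by
  have := hφ.map_mul_eq_zero (S := M (f - φ (M f) • 1))
    (by rw [(hM.isSelfAdjoint _).star_eq]; exact hM.apply_sub_sq hφ hf) T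
  rw [hM.map_sub_smul_one, mul_sub, mul_smul_comm, mul_one, map_sub, map_smul,
    smul_eq_mul] at this
  linarith

theorem apply_map_mul (hM : IsCovariantRep u M) (hφ : IsRealState φ)
    (hf : φ (M (f * f)) = φ (M f) ^ 2) (T : H →L[ℂ] H) : φ (M f * T) = φ (M f) * φ T := by
  have := hφ.map_mul_eq_zero_of_isSelfAdjoint (hM.isSelfAdjoint _) (hM.apply_sub_sq hφ hf) T
  rw [hM.map_sub_smul_one, sub_mul, smul_mul_assoc, one_mul, map_sub, map_smul,
    smul_eq_mul] at this
  linarith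

omit [CompleteSpace H] in
theorem map_inv_mul_self (g : G) : u g⁻¹ * u g = 1 := by
  rw [← _root_.map_mul, inv_mul_cancel, _root_.map_one]

theorem norm_apply (hM : IsCovariantRep u M) (g : G) (ξ : H) : ‖u g ξ‖ = ‖ξ‖ := by
  refine (ContinuousLinearMap.norm_map_iff_adjoint_comp_self (u g)).2 ?_ ξ
  rw [← ContinuousLinearMap.star_eq_adjoint, hM.star_map]
  exact map_inv_mul_self g

theorem norm_le (hM : IsCovariantRep u M) (g : G) : ‖u g‖ ≤ 1 :=
  ContinuousLinearMap.opNorm_le_bound _ zero_le_one fun ξ => by rw [hM.norm_apply, one_mul]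

theorem norm_conj_le (hM : IsCovariantRep u M) (g : G) (T : H →L[ℂ] H) :
    ‖u g⁻¹ * T * u g‖ ≤ ‖T‖ := by
  calc ‖u g⁻¹ * T * u g‖ ≤ ‖u g⁻¹‖ * ‖T‖ * ‖u g‖ :=
        (norm_mul_le _ _).trans (mul_le_mul_of_nonneg_right (norm_mul_le _ _) (norm_nonneg _))
    _ ≤ 1 * ‖T‖ * 1 := by
        gcongr
        · exact hM.norm_le _
        · exact hM.norm_le _
    _ = ‖T‖ := by ring

theorem reApplyInnerSelf_conj (hM : IsCovariantRep u M) (g : G) (T : H →L[ℂ] H) (ξ : H) :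
    (u g⁻¹ * T * u g).reApplyInnerSelf ξ = T.reApplyInnerSelf (u g ξ) := by
  rw [ContinuousLinearMap.reApplyInnerSelf_apply, ContinuousLinearMap.reApplyInnerSelf_apply,
    ← hM.star_map, ContinuousLinearMap.star_eq_adjoint]
  exact congrArg _ (ContinuousLinearMap.adjoint_inner_left _ _ _)

theorem conj_map (hM : IsCovariantRep u M) (g : G) (f : EllInfty G) :
    u g⁻¹ * M f * u g = M (leftShift g f) := by
  rw [hM.covariant, inv_inv, mul_assoc, map_inv_mul_self, mul_one]

/-- The orbit function `g ↦ φ(u(g)* T u(g))`. -/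
noncomputable def orbitFunction (hM : IsCovariantRep u M) (hφ : IsRealState φ) :
    (H →L[ℂ] H) →ₗ[ℝ] EllInfty G where
  toFun T := ofBound (fun g => φ (u g⁻¹ * T * u g)) ‖T‖
    fun g => (hφ.abs_le _).trans (hM.norm_conj_le g T)
  map_add' S T := by
    ext g
    change φ (_ * (S + T) * _) = φ (_ * S * _) + φ (_ * T * _)
    rw [mul_add, add_mul, map_add]
  map_smul' c T := by
    ext g
    change φ (_ * (c • T) * _) = c * φ (_ * T * _)
    rw [mul_smul_comm, smul_mul_assoc, map_smul, smul_eq_mul]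

@[simp] theorem orbitFunction_apply (hM : IsCovariantRep u M) (hφ : IsRealState φ)
    (T : H →L[ℂ] H) (g : G) : hM.orbitFunction hφ T g = φ (u g⁻¹ * T * u g) := rfl

/-- The average of the translates of a state with respect to a mean. -/
noncomputable def averageState (hM : IsCovariantRep u M) (ψ : WeakDual ℝ (EllInfty G))
    (hφ : IsRealState φ) : (H →L[ℂ] H) →ₗ[ℝ] ℝ :=
  (WeakDual.toStrongDual ψ).toLinearMap ∘ₗ hM.orbitFunction hφ

theorem averageState_apply (hM : IsCovariantRep u M) (ψ : WeakDual ℝ (EllInfty G))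
    (hφ : IsRealState φ) (T : H →L[ℂ] H) :
    hM.averageState ψ hφ T = ψ (hM.orbitFunction hφ T) := rfl

theorem averageState_eq_of_forall (hM : IsCovariantRep u M) {ψ : WeakDual ℝ (EllInfty G)}
    (hψ : ψ ∈ means G) (hφ : IsRealState φ) {T : H →L[ℂ] H} {c : ℝ}
    (hT : ∀ g, φ (u g⁻¹ * T * u g) = c) : hM.averageState ψ hφ T = c := by
  have : hM.orbitFunction hφ T = c • 1 := by
    ext g
    rw [orbitFunction_apply, hT]
    exact (mul_one c).symm
  rw [averageState_apply, this, map_smul, hψ.2, smul_eq_mul, mul_one]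

theorem isRealState_averageState (hM : IsCovariantRep u M) {ψ : WeakDual ℝ (EllInfty G)}
    (hψ : ψ ∈ means G) (hφ : IsRealState φ) : IsRealState (hM.averageState ψ hφ) where
  nonneg T hT := hψ.1 _ fun g => hφ.nonneg _ fun ξ => by
    rw [hM.reApplyInnerSelf_conj]; exact hT _
  map_one := hM.averageState_eq_of_forall hψ hφ fun g => by
    rw [mul_one, map_inv_mul_self, hφ.map_one]

/-- By covariance, averaging states over G becomes left Arens multiplication on means, so states can
be steered within left ideals. -/
theorem restrictMean_averageState (hM : IsCovariantRep u M) {ψ : WeakDual ℝ (EllInfty G)}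
    (hψ : ψ ∈ means G) (hφ : IsRealState φ) :
    hM.restrictMean (hM.isRealState_averageState hψ hφ) = arens ψ (hM.restrictMean hφ) := by
  refine DFunLike.ext _ _ fun f => ?_
  rw [restrictMean_apply, averageState_apply, arens_apply]
  congr 1
  ext g
  rw [orbitFunction_apply, poisson_apply, restrictMean_apply, hM.conj_map]

/-- With F = P_k f in the multiplicative domain, φ applied to u(s)M(L_s F) = M(F)u(s) gives the same
number times two different scalars. The factor z is carried along because φ is only real-linear. -/
theorem apply_smul_eq_zero (hM : IsCovariantRep u M) (hφ : IsRealState φ)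
    {J : Set (WeakDual ℝ (EllInfty G))} (hJ : IsClosedLeftIdeal J)
    {k x : WeakDual ℝ (EllInfty G)} (hk : k ∈ J) (hφx : arens (hM.restrictMean hφ) k = x)
    (hx : x ∈ J.extremePoints ℝ) {s : G} (hs : arens (evalMean s) x ≠ x) (z : ℂ) :
    φ (z • u s) = 0 := by
  subst hφx
  have hsq (f : EllInfty G) : φ (M (poisson k f * poisson k f)) = φ (M (poisson k f)) ^ 2 :=
    map_poisson_mul_self_of_mem_extremePoints hJ hk (hM.restrictMean_mem hφ) hx f
  obtain ⟨f, hf⟩ := DFunLike.ne_iff.1 hs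
  rw [arens_evalMean_apply, arens_apply, arens_apply, restrictMean_apply, restrictMean_apply] at hf
  have h1 := hM.apply_mul_map hφ (hsq (leftShift s f)) (z • u s)
  have h2 := hM.apply_map_mul hφ (hsq f) (z • u s)
  rw [smul_mul_assoc, hM.covariant, poisson_leftShift, leftShift_leftShift,
    mul_inv_cancel, leftShift_one] at h1
  rw [mul_smul_comm, h1] at h2
  rw [poisson_leftShift] at hf
  by_contra hne
  exact hf (mul_right_cancel₀ hne h2)

/-- A conjugation-invariant state on a closed star-subalgebra containing `u(G)` vanishes on `u(t)`
unless `t` lies in the amenable radical. -/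
theorem map_eq_zero_of_notMem_amenableRadical (hM : IsCovariantRep u M)
    (A : StarSubalgebra ℂ (H →L[ℂ] H)) (hA : IsClosed (A : Set (H →L[ℂ] H)))
    (hu : ∀ t, u t ∈ A) (τ : A →ₗ[ℂ] ℂ) (hτ : ∀ a : A, 0 ≤ τ (star a * a)) (hτ1 : τ 1 = 1)
    (hconj : ∀ (g : G) (a : A), τ (⟨u g⁻¹, hu _⟩ * a * ⟨u g, hu _⟩) = τ a)
    {t : G} (ht : t ∉ amenableRadical G) : τ ⟨u t, hu t⟩ = 0 := by
  obtain ⟨J, hJ⟩ := exists_minimal_closedLeftIdeal G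
  rw [← actionKernel_eq_amenableRadical hJ] at ht
  obtain ⟨x, hx⟩ := (isCompact_means.of_isClosed_subset hJ.prop.2.1
    hJ.prop.2.2.1).extremePoints_nonempty hJ.prop.1
  have hxJ : x ∈ J := hx.1
  obtain ⟨g, hg⟩ : ∃ g : G, arens (evalMean (g⁻¹ * t * g)) x ≠ x := by
    by_contra! hall
    refine ht fun y hy => ?_
    obtain ⟨ψ, -, rfl⟩ := exists_arens_eq_of_minimal hJ hxJ hy
    exact arens_evalMean_arens_of_conj hall ψ
  obtain ⟨φ₀, hφ₀, hτ₀⟩ := exists_isRealState_extension A hA τ hτ hτ1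
  -- Minimality lets some ψ bring μ₀ * x back to x, where μ₀ is the restriction of φ₀. Averaging φ₀
  -- over ψ then yields a state whose mean ψ * μ₀ satisfies (ψ * μ₀) * x = x.
  obtain ⟨ψ, hψ, hψx⟩ := exists_arens_eq_of_minimal hJ
    (hJ.prop.2.2.2 _ (hM.restrictMean_mem hφ₀) x hxJ) hxJ
  have hφ := hM.isRealState_averageState hψ hφ₀
  have hφx : arens (hM.restrictMean hφ) x = x := by
    rw [hM.restrictMean_averageState hψ hφ₀, arens_assoc, hψx]
  have hφτ (a : A) : hM.averageState ψ hφ₀ a = (τ a).re :=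
    hM.averageState_eq_of_forall hψ hφ₀ fun g => by
      rw [← hconj g a, ← hτ₀]; rfl
  have hre (z : ℂ) : (z * τ ⟨u t, hu t⟩).re = 0 := by
    have hmul : (⟨u g⁻¹, hu _⟩ * ⟨u t, hu t⟩ * ⟨u g, hu _⟩ : A) =
        ⟨u (g⁻¹ * t * g), hu _⟩ := Subtype.ext (by simp)
    rw [← hconj g, hmul, ← smul_eq_mul, ← map_smul, ← hφτ]
    exact hM.apply_smul_eq_zero hφ hJ.prop hxJ hφx hx hg z
  -- The scalars 1 and i recover the real and imaginary parts.
  have h1 := hre 1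
  have h2 := hre Complex.I
  rw [one_mul] at h1
  rw [Complex.I_mul_re, neg_eq_zero] at h2
  exact Complex.ext h1 h2

end IsCovariantRep

/-! ### The C*-algebra generated by a unitary representation -/

section Generated

variable {G H : Type*} [Group G] [NormedAddCommGroup H] [InnerProductSpace ℂ H] [CompleteSpace H]
  (u : G →* (H →L[ℂ] H))

theorem topologicalClosure_adjoin_range_subset (hu : ∀ g, star (u g) = u g⁻¹) :
    ((StarAlgebra.adjoin ℂ (Set.range u)).topologicalClosure : Set (H →L[ℂ] H)) ⊆
      closure (Submodule.span ℂ (Set.range u)) := by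
  have hstar : ∀ T ∈ Submodule.span ℂ (Set.range u), star T ∈ Submodule.span ℂ (Set.range u) := by
    intro T hT
    induction hT using Submodule.span_induction with
    | mem T h =>
      obtain ⟨s, rfl⟩ := h
      rw [hu]
      exact Submodule.subset_span ⟨_, rfl⟩
    | zero => rw [star_zero]; exact zero_mem _
    | add S T _ _ hS hT => rw [star_add]; exact add_mem hS hT
    | smul c T _ hT => rw [star_smul]; exact Submodule.smul_mem _ _ hT
  refine closure_mono fun T hT => ?_
  induction hT using StarAlgebra.adjoin_induction with
  | mem T h => exact Submodule.subset_span h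
  | algebraMap c =>
    rw [Algebra.algebraMap_eq_smul_one, ← map_one u]
    exact Submodule.smul_mem _ _ (Submodule.subset_span ⟨1, rfl⟩)
  | add S T _ _ hS hT => exact add_mem hS hT
  | mul S T _ _ hS hT =>
    have := Submodule.mul_mem_mul hS hT
    rw [Submodule.span_mul_span] at this
    refine Submodule.span_mono ?_ this
    rintro _ ⟨_, ⟨s, rfl⟩, _, ⟨t, rfl⟩, rfl⟩
    exact ⟨s * t, map_mul _ _ _⟩
  | star T _ hT => exact hstar T hT

/-- Bounded functionals on the C*-algebra generated by `u` which agree on `u` are equal. -/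
theorem ext_of_forall_map_eq (hu : ∀ g, star (u g) = u g⁻¹) (A : StarSubalgebra ℂ (H →L[ℂ] H))
    (hA : A ≤ (StarAlgebra.adjoin ℂ (Set.range u)).topologicalClosure) (huA : ∀ t, u t ∈ A)
    {τ σ : A →ₗ[ℂ] ℂ} {C D : ℝ} (hτ : ∀ a, ‖τ a‖ ≤ C * ‖a‖) (hσ : ∀ a, ‖σ a‖ ≤ D * ‖a‖)
    (h : ∀ t, τ ⟨u t, huA t⟩ = σ ⟨u t, huA t⟩) : τ = σ := by
  let of : G → A := fun t => ⟨u t, huA t⟩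
  have himage : (Subtype.val '' (Submodule.span ℂ (Set.range of) : Set A)) =
      Submodule.span ℂ (Set.range u) := by
    have := Submodule.map_span A.subtype.toAlgHom.toLinearMap (Set.range of)
    rw [← Set.range_comp] at this
    exact congrArg SetLike.coe this
  have hdense : Dense (Submodule.span ℂ (Set.range of) : Set A) := by
    have hsub : (A : Set (H →L[ℂ] H)) ⊆ closure (Submodule.span ℂ (Set.range u)) := fun T hT =>
      topologicalClosure_adjoin_range_subset u hu (hA hT)
    exact Subtype.dense_iff.2 (hsub.trans (closure_mono himage.ge))
  have : τ.mkContinuous C hτ = σ.mkContinuous D hσ :=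
    ContinuousLinearMap.ext_on hdense (by rintro _ ⟨t, rfl⟩; exact h t)
  exact LinearMap.ext fun a => DFunLike.congr_fun this a

/-- A bounded functional which is tracial on `u` is tracial on the C*-algebra generated by `u`. -/
theorem map_mul_comm_of_forall (hu : ∀ g, star (u g) = u g⁻¹) {τ : (H →L[ℂ] H) →L[ℂ] ℂ}
    (h : ∀ s t, τ (u (s * t)) = τ (u (t * s))) {S T : H →L[ℂ] H}
    (hS : S ∈ (StarAlgebra.adjoin ℂ (Set.range u)).topologicalClosure)
    (hT : T ∈ (StarAlgebra.adjoin ℂ (Set.range u)).topologicalClosure) :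
    τ (S * T) = τ (T * S) := by
  have key (R : H →L[ℂ] H) (hR : ∀ t, τ (R * u t) = τ (u t * R)) {T : H →L[ℂ] H}
      (hT : T ∈ (StarAlgebra.adjoin ℂ (Set.range u)).topologicalClosure) :
      τ (R * T) = τ (T * R) :=
    ContinuousLinearMap.eqOn_closure_span (f := τ.comp (ContinuousLinearMap.mul ℂ (H →L[ℂ] H) R))
      (g := τ.comp ((ContinuousLinearMap.mul ℂ (H →L[ℂ] H)).flip R)) (s := Set.range u)
      (by rintro _ ⟨t, rfl⟩; exact hR t) (topologicalClosure_adjoin_range_subset u hu hT)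
  -- Density is used once per variable: first with R = u(t), then with R = S.
  exact key S (fun t => (key (u t) (fun s => by rw [← map_mul, ← map_mul, h]) hS).symm) hT

/-- A positive unital functional on a closed star-subalgebra is bounded. -/
theorem norm_map_le_of_nonneg (A : StarSubalgebra ℂ (H →L[ℂ] H))
    (hA : IsClosed (A : Set (H →L[ℂ] H))) {τ : A →ₗ[ℂ] ℂ}
    (hτ : ∀ a : A, 0 ≤ τ (star a * a)) (h1 : τ 1 = 1) (a : A) : ‖τ a‖ ≤ 2 * ‖a‖ := by
  obtain ⟨φ, hφ, hτφ⟩ := exists_isRealState_extension A hA τ hτ h1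
  have hre (b : A) : |(τ b).re| ≤ ‖b‖ := by
    rw [← hτφ]; exact hφ.abs_le _
  have him : |(τ a).im| ≤ ‖a‖ := by
    have := hre (Complex.I • a)
    rwa [map_smul, smul_eq_mul, Complex.I_mul_re, abs_neg, norm_smul, Complex.norm_I,
      one_mul] at this
  linarith [Complex.norm_le_abs_re_add_abs_im (τ a), hre a]

/-- Limits of vector states. -/
theorem exists_limit_vectorState {ι : Type*} (l : Filter ι) [l.NeBot] (ξ : ι → H)
    (hξ : ∀ i, ‖ξ i‖ = 1) :
    ∃ τ : (H →L[ℂ] H) →L[ℂ] ℂ, (∀ T, 0 ≤ τ (star T * T)) ∧ τ 1 = 1 ∧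
      ∀ T c, Filter.Tendsto (fun i => inner ℂ (ξ i) (T (ξ i))) l (nhds c) → τ T = c := by
  have hle (i : ι) (T : H →L[ℂ] H) : ‖inner ℂ (ξ i) (T (ξ i))‖ ≤ 1 * ‖T‖ := by
    refine (norm_inner_le_norm _ _).trans ?_
    have := T.le_opNorm (ξ i)
    rw [hξ, mul_one] at this
    rwa [hξ, one_mul, one_mul]
  let ω : ι → WeakDual ℂ (H →L[ℂ] H) := fun i => StrongDual.toWeakDual
    (LinearMap.mkContinuous
      { toFun := fun T => inner ℂ (ξ i) (T (ξ i))
        map_add' := fun S T => by rw [add_apply, inner_add_right]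
        map_smul' := fun c T => by
          rw [smul_apply, inner_smul_right]; rfl } 1 (hle i))
  have hω (i : ι) (T : H →L[ℂ] H) : ω i T = inner ℂ (ξ i) (T (ξ i)) := rfl
  obtain ⟨τ, -, hτ⟩ := (WeakDual.isCompact_closedBall (𝕜 := ℂ) (E := H →L[ℂ] H) 0 1
    ).ultrafilter_le_nhds ((Ultrafilter.of l).map ω) (by
      rw [Filter.le_principal_iff]
      refine Filter.mem_map.2 (Filter.univ_mem' fun i => ?_)
      simp only [Set.mem_preimage, Metric.mem_closedBall, dist_zero_right]
      exact ContinuousLinearMap.opNorm_le_bound _ zero_le_one (hle i))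
  have hlim (T : H →L[ℂ] H) : Filter.Tendsto (fun i => inner ℂ (ξ i) (T (ξ i)))
      (Ultrafilter.of l : Filter ι) (nhds (τ T)) :=
    ((WeakDual.eval_continuous T).tendsto τ).comp hτ
  have huniq (T : H →L[ℂ] H) (c : ℂ)
      (h : Filter.Tendsto (fun i => inner ℂ (ξ i) (T (ξ i))) l (nhds c)) : τ T = c :=
    tendsto_nhds_unique (hlim T) (h.mono_left (Ultrafilter.of_le l))
  refine ⟨WeakDual.toStrongDual τ, fun T => ?_, ?_, huniq⟩
  · refine ge_of_tendsto' (hlim (star T * T)) fun i => ?_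
    rw [mul_apply_eq_comp, ContinuousLinearMap.star_eq_adjoint,
      ContinuousLinearMap.adjoint_inner_right, inner_self_eq_norm_sq_to_K,
      ← RCLike.ofReal_pow]
    exact RCLike.ofReal_nonneg.2 (sq_nonneg _)
  · refine huniq 1 1 (tendsto_const_nhds.congr fun i => ?_)
    rw [one_apply_eq_self, inner_self_eq_norm_sq_to_K, hξ]
    simp

end Generated

/-! ### The regular covariant representation -/

section Regular

variable {G : Type*}

/-- The multiplication operator on `ℓ²(G)` by a bounded real function. -/
noncomputable def mulOp (f : EllInfty G) : EllTwo G →L[ℂ] EllTwo G :=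
  have hle (ξ : EllTwo G) (x : G) : ‖(f x : ℂ) * ξ x‖ ≤ ‖((‖f‖ : ℂ) • ξ) x‖ := by
    rw [lp.coeFn_smul, Pi.smul_apply, smul_eq_mul, norm_mul, norm_mul, Complex.norm_real,
      Complex.norm_real, norm_norm]
    exact mul_le_mul_of_nonneg_right (abs_apply_le f x) (norm_nonneg _)
  LinearMap.mkContinuous
    { toFun := fun ξ => ⟨fun x => (f x : ℂ) * ξ x,
        (lp.memℓp ((‖f‖ : ℂ) • ξ)).mono' (hle ξ)⟩
      map_add' := fun ξ η => by ext x; exact mul_add _ _ _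
      map_smul' := fun c ξ => by ext x; exact mul_left_comm _ _ _ }
    ‖f‖ fun ξ => by
      refine (lp.norm_mono (by norm_num) (y := (‖f‖ : ℂ) • ξ) (hle ξ)).trans ?_
      rw [norm_smul, Complex.norm_real, norm_norm]

@[simp] theorem mulOp_apply (f : EllInfty G) (ξ : EllTwo G) (x : G) :
    mulOp f ξ x = f x * ξ x := rfl

/-- `mulOp` as a linear map. -/
noncomputable def mulOpLinear (G : Type*) : EllInfty G →ₗ[ℝ] (EllTwo G →L[ℂ] EllTwo G) where
  toFun := mulOp
  map_add' f g := by
    ext ξ x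
    change ((f x + g x : ℝ) : ℂ) * ξ x = f x * ξ x + g x * ξ x
    push_cast; ring
  map_smul' c f := by
    ext ξ x
    change ((c * f x : ℝ) : ℂ) * ξ x = c • (f x * ξ x)
    rw [Complex.real_smul]; push_cast; ring

theorem mulOp_one : mulOp (1 : EllInfty G) = 1 := by
  ext ξ x
  change ((1 : ℝ) : ℂ) * ξ x = ξ x
  simp

theorem mulOp_mul (f g : EllInfty G) : mulOp (f * g) = mulOp f * mulOp g := by
  ext ξ x
  change ((f x * g x : ℝ) : ℂ) * ξ x = f x * (g x * ξ x)
  push_cast; ring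

theorem inner_mulOp_left (f : EllInfty G) (ξ η : EllTwo G) :
    inner ℂ (mulOp f ξ) η = inner ℂ ξ (mulOp f η) := by
  rw [lp.inner_eq_tsum, lp.inner_eq_tsum]
  refine tsum_congr fun x => ?_
  rw [mulOp_apply, mulOp_apply, ← smul_eq_mul, ← smul_eq_mul, inner_smul_left, inner_smul_right,
    Complex.conj_ofReal]

theorem isSelfAdjoint_mulOp (f : EllInfty G) : IsSelfAdjoint (mulOp f) :=
  ContinuousLinearMap.isSelfAdjoint_iff_isSymmetric.2 fun ξ η => inner_mulOp_left f ξ η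

theorem reApplyInnerSelf_mulOp_nonneg {f : EllInfty G} (hf : ∀ x, 0 ≤ f x) (ξ : EllTwo G) :
    0 ≤ (mulOp f).reApplyInnerSelf ξ := by
  rw [ContinuousLinearMap.reApplyInnerSelf_apply]
  refine (RCLike.hasSum_re ℂ (lp.hasSum_inner (mulOp f ξ) ξ)).nonneg fun x => ?_
  rw [mulOp_apply, ← smul_eq_mul, inner_smul_left, Complex.conj_ofReal]
  have : RCLike.re ((f x : ℂ) * inner ℂ (ξ x) (ξ x)) = f x * ‖ξ x‖ ^ 2 := by
    rw [← inner_self_eq_norm_sq (𝕜 := ℂ)]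
    exact RCLike.re_ofReal_mul _ _
  rw [this]
  exact mul_nonneg (hf x) (sq_nonneg _)

variable [Group G]

theorem norm_leftRegular_apply (g : G) (ξ : EllTwo G) : ‖leftRegular G g ξ‖ = ‖ξ‖ :=
  (leftTranslate g).norm_map ξ

theorem star_leftRegular (g : G) : star (leftRegular G g) = leftRegular G g⁻¹ := by
  have h : star (leftRegular G g) * leftRegular G g = 1 :=
    (ContinuousLinearMap.norm_map_iff_adjoint_comp_self _).1 (norm_leftRegular_apply g)
  have h' : leftRegular G g * leftRegular G g⁻¹ = 1 := by
    rw [← map_mul, mul_inv_cancel, map_one]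
  exact left_inv_eq_right_inv h h'

theorem leftRegular_mul_mulOp (t : G) (f : EllInfty G) :
    leftRegular G t * mulOp f = mulOp (leftShift t⁻¹ f) * leftRegular G t := by
  ext ξ x; rfl

theorem isCovariantRep_leftRegular (G : Type*) [Group G] :
    IsCovariantRep (leftRegular G) (mulOpLinear G) where
  star_map := star_leftRegular
  map_one := mulOp_one
  map_mul := mulOp_mul
  isSelfAdjoint := isSelfAdjoint_mulOp
  nonneg _ hf := reApplyInnerSelf_mulOp_nonneg hf
  covariant := leftRegular_mul_mulOp

end Regular

/-! ### Tracial states on the reduced group C*-algebra -/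

section Traces

variable {G : Type*} [Group G]

theorem isClosed_reducedGroupCStar :
    IsClosed (reducedGroupCStar G : Set (EllTwo G →L[ℂ] EllTwo G)) :=
  StarSubalgebra.isClosed_topologicalClosure _

theorem reducedGroupCStar.of_mul (s t : G) :
    reducedGroupCStar.of (s * t) = reducedGroupCStar.of s * reducedGroupCStar.of t :=
  Subtype.ext (map_mul (leftRegular G) s t)

theorem reducedGroupCStar.of_one : reducedGroupCStar.of (1 : G) = 1 :=
  Subtype.ext (map_one (leftRegular G))

theorem IsTracialState.map_conj {τ : reducedGroupCStar G →ₗ[ℂ] ℂ} (hτ : IsTracialState τ) (g : G)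
    (a : reducedGroupCStar G) :
    τ (reducedGroupCStar.of g⁻¹ * a * reducedGroupCStar.of g) = τ a := by
  rw [hτ.map_mul_comm, ← mul_assoc, ← reducedGroupCStar.of_mul, mul_inv_cancel,
    reducedGroupCStar.of_one, one_mul]

/-- A tracial state on the reduced group C*-algebra vanishes off the amenable radical. -/
theorem IsTracialState.map_of_eq_zero {τ : reducedGroupCStar G →ₗ[ℂ] ℂ} (hτ : IsTracialState τ)
    {t : G} (ht : t ∉ amenableRadical G) : τ (reducedGroupCStar.of t) = 0 :=
  (isCovariantRep_leftRegular G).map_eq_zero_of_notMem_amenableRadical (reducedGroupCStar G)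
    isClosed_reducedGroupCStar (fun t => (reducedGroupCStar.of t).2) τ hτ.nonneg hτ.map_one
    hτ.map_conj ht

/-- A tracial state is bounded. -/
theorem IsTracialState.norm_le {τ : reducedGroupCStar G →ₗ[ℂ] ℂ} (hτ : IsTracialState τ)
    (a : reducedGroupCStar G) : ‖τ a‖ ≤ 2 * ‖a‖ :=
  norm_map_le_of_nonneg _ isClosed_reducedGroupCStar hτ.nonneg hτ.map_one a

/-- A tracial state is determined by its values on the group elements. -/
theorem IsTracialState.ext {τ σ : reducedGroupCStar G →ₗ[ℂ] ℂ} (hτ : IsTracialState τ)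
    (hσ : IsTracialState σ)
    (h : ∀ t : G, τ (reducedGroupCStar.of t) = σ (reducedGroupCStar.of t)) : τ = σ :=
  ext_of_forall_map_eq (leftRegular G) star_leftRegular (reducedGroupCStar G) le_rfl
    (fun t => (reducedGroupCStar.of t).2) hτ.norm_le hσ.norm_le h

/-- A state of `B(ℓ²(G))` which is tracial on the group elements restricts to a tracial state. -/
theorem isTracialState_restrict {τ : (EllTwo G →L[ℂ] EllTwo G) →L[ℂ] ℂ}
    (hτ : ∀ T, 0 ≤ τ (star T * T)) (hτ1 : τ 1 = 1)
    (h : ∀ s t : G, τ (leftRegular G (s * t)) = τ (leftRegular G (t * s))) :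
    IsTracialState (τ.toLinearMap ∘ₗ (reducedGroupCStar G).subtype.toAlgHom.toLinearMap) where
  nonneg a := hτ a
  map_one := hτ1
  map_mul_comm a b := map_mul_comm_of_forall (leftRegular G) star_leftRegular h a.2 b.2

end Traces

/-! ### Almost invariant vectors -/

section Day

variable {G : Type*} [Group G]

theorem memlp_one_leftTranslate (s : G) (p : lp (fun _ : G => ℝ) 1) :
    Memℓp (fun x : G => p (s⁻¹ * x)) 1 :=
  memℓp_gen (((lp.memℓp p).summable (by norm_num)).comp_injective (mul_right_injective s⁻¹))

/-- Left translation on `ℓ¹(G)`. -/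
noncomputable def ellOneTranslate (s : G) :
    lp (fun _ : G => ℝ) 1 →ₗ[ℝ] lp (fun _ : G => ℝ) 1 where
  toFun p := ⟨fun x => p (s⁻¹ * x), memlp_one_leftTranslate s p⟩
  map_add' _ _ := rfl
  map_smul' _ _ := rfl

theorem ellOneTranslate_apply (s : G) (p : lp (fun _ : G => ℝ) 1) (x : G) :
    ellOneTranslate s p x = p (s⁻¹ * x) := rfl

open Classical in
theorem ellOneTranslate_single (s x : G) :
    ellOneTranslate s (lp.single 1 x (1 : ℝ)) = lp.single 1 (s * x) (1 : ℝ) := by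
  ext y
  rw [ellOneTranslate_apply, lp.single_apply, lp.single_apply, Pi.single_apply, Pi.single_apply]
  simp only [inv_mul_eq_iff_eq_mul]

/-- The probability vectors in `ℓ¹(G)` supported on `N`. -/
def probVectors (N : Subgroup G) : Set (lp (fun _ : G => ℝ) 1) :=
  {p | (∀ x, 0 ≤ p x) ∧ (∀ x ∉ N, p x = 0) ∧ HasSum (fun x => p x) 1}

theorem convex_probVectors (N : Subgroup G) : Convex ℝ (probVectors N) := by
  intro p hp q hq a b ha hb hab
  refine ⟨fun x => add_nonneg (mul_nonneg ha (hp.1 x)) (mul_nonneg hb (hq.1 x)), fun x hx => ?_, ?_⟩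
  · change a * p x + b * q x = 0
    rw [hp.2.1 x hx, hq.2.1 x hx, mul_zero, mul_zero, add_zero]
  · have := (hp.2.2.mul_left a).add (hq.2.2.mul_left b)
    rwa [mul_one, mul_one, hab] at this

open Classical in
theorem single_mem_probVectors {N : Subgroup G} {x : G} (hx : x ∈ N) :
    lp.single 1 x (1 : ℝ) ∈ probVectors N := by
  refine ⟨fun y => ?_, fun y hy => ?_, ?_⟩
  · rw [lp.single_apply, Pi.single_apply]; split_ifs <;> norm_num
  · exact lp.single_apply_ne _ _ _ (by rintro rfl; exact hy hx)
  · have := hasSum_single (f := fun y => lp.single (E := fun _ : G => ℝ) 1 x (1 : ℝ) y) x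
      fun y hy => lp.single_apply_ne _ _ _ hy
    rwa [lp.single_apply_self] at this

/-- Day's theorem: an amenable group admits almost invariant probability vectors. -/
theorem exists_almost_invariant_probVector {N : Subgroup G} (hN : IsAmenableGroup N)
    (F : Finset N) {ε : ℝ} (hε : 0 < ε) :
    ∃ p ∈ probVectors N, ∀ s ∈ F, ‖ellOneTranslate (s : G) p - p‖ < ε := by
  classical
  let D : lp (fun _ : G => ℝ) 1 →ₗ[ℝ] (F → lp (fun _ : G => ℝ) 1) :=
    LinearMap.pi fun s => ellOneTranslate (s : G) - LinearMap.id
  have hD (p : lp (fun _ : G => ℝ) 1) (s : F) : D p s = ellOneTranslate (s : G) p - p := rfl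
  suffices h0 : (0 : F → lp (fun _ : G => ℝ) 1) ∈ closure (D '' probVectors N) by
    obtain ⟨_, ⟨p, hp, rfl⟩, hlt⟩ := Metric.mem_closure_iff.1 h0 ε hε
    rw [dist_zero_left] at hlt
    exact ⟨p, hp, fun s hs => (norm_le_pi_norm (D p) ⟨s, hs⟩).trans_lt hlt⟩
  -- Otherwise Hahn–Banach separates 0 from the convex set of displacements by a functional L > c >
  -- 0. Evaluated at point masses, L ∘ D is a bounded function h on N that exceeds c, yet is a sum
  -- of differences of translates, so the invariant mean kills it.
  by_contra h0
  obtain ⟨L, c, hc, hL⟩ := geometric_hahn_banach_point_closed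
    ((convex_probVectors N).linear_image D).closure isClosed_closure h0
  rw [map_zero] at hc
  obtain ⟨m, hm, hm1, hinv⟩ := hN
  let δ : G → lp (fun _ : G => ℝ) 1 := fun x => lp.single 1 x (1 : ℝ)
  let Ls : F → StrongDual ℝ (lp (fun _ : G => ℝ) 1) := fun s =>
    L.comp (ContinuousLinearMap.single ℝ (fun _ : F => lp (fun _ : G => ℝ) 1) s)
  have hLs (v : F → lp (fun _ : G => ℝ) 1) : L v = ∑ s : F, Ls s (v s) := by
    conv_lhs => rw [← Finset.univ_sum_single v, map_sum]
    rfl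
  let f : F → EllInfty N := fun s => ofBound (fun x => Ls s (δ x)) ‖Ls s‖ fun x => by
    have := (Ls s).le_opNorm (δ x)
    rwa [lp.norm_single (by norm_num), norm_one, mul_one] at this
  let h : EllInfty N := ∑ s : F, (leftShift (s : N) (f s) - f s)
  have hmh : m h = 0 := by
    rw [map_sum]
    refine Finset.sum_eq_zero fun s _ => ?_
    rw [map_sub, hinv (s : N) (f s) (leftShift (s : N) (f s)) fun _ => rfl, sub_self]
  have hhx (x : N) : c < h x := by
    have h1 := hL _ (subset_closure ⟨δ x, single_mem_probVectors x.2, rfl⟩)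
    have h2 : h x = L (D (δ x)) := by
      rw [hLs, lp.coeFn_sum, Finset.sum_apply]
      refine Finset.sum_congr rfl fun s _ => ?_
      rw [hD, map_sub, ellOneTranslate_single]
      rfl
    rwa [h2]
  have := hm (h - c • 1) fun x => by
    have h3 : (h - c • 1) x = h x - c * 1 := rfl
    rw [h3]; linarith [hhx x]
  rw [map_sub, map_smul, hm1, hmh, smul_eq_mul] at this
  linarith

/-- Summed over G, this bounds the squared `ℓ²` displacement of √p by the `ℓ¹` displacement of p. -/
theorem sq_sqrt_sub_sqrt_le {a b : ℝ} (ha : 0 ≤ a) (hb : 0 ≤ b) :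
    (√a - √b) ^ 2 ≤ |a - b| := by
  have h : |a - b| = |√a - √b| * (√a + √b) := by
    rw [← abs_of_nonneg (add_nonneg (Real.sqrt_nonneg a) (Real.sqrt_nonneg b)), ← abs_mul]
    congr 1
    nlinarith [Real.sq_sqrt ha, Real.sq_sqrt hb]
  rw [h, ← sq_abs, sq]
  refine mul_le_mul_of_nonneg_left ?_ (abs_nonneg _)
  exact abs_le.2 ⟨by linarith [Real.sqrt_nonneg a], by linarith [Real.sqrt_nonneg b]⟩

/-- An amenable subgroup admits almost invariant unit vectors in `ℓ²(G)` supported on it. -/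
theorem exists_almost_invariant_vector {N : Subgroup G} (hN : IsAmenableGroup N)
    (F : Finset N) {ε : ℝ} (hε : 0 < ε) :
    ∃ ξ : EllTwo G, ‖ξ‖ = 1 ∧ (∀ x ∉ N, ξ x = 0) ∧
      ∀ s ∈ F, ‖leftRegular G (s : G) ξ - ξ‖ < ε := by
  -- The tolerance is ε² because passing from p to ξ = √p costs a square root.
  obtain ⟨p, ⟨hp0, hpN, hp1⟩, hpF⟩ := exists_almost_invariant_probVector hN F (pow_pos hε 2)
  have hsq (x : G) : ‖((√(p x) : ℝ) : ℂ)‖ ^ (2 : ℝ≥0∞).toReal = p x := by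
    rw [Complex.norm_real, Real.norm_of_nonneg (Real.sqrt_nonneg _), ENNReal.toReal_ofNat,
      Real.rpow_two, Real.sq_sqrt (hp0 x)]
  let ξ : EllTwo G := ⟨fun x => ((√(p x) : ℝ) : ℂ),
    memℓp_gen (by simpa only [hsq] using hp1.summable)⟩
  have hξx (x : G) : ξ x = ((√(p x) : ℝ) : ℂ) := rfl
  refine ⟨ξ, ?_, fun x hx => ?_, fun s hs => ?_⟩
  · have h : ‖ξ‖ ^ (2 : ℝ≥0∞).toReal = 1 := by
      rw [lp.norm_rpow_eq_tsum (by norm_num)]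
      simp only [hξx, hsq]
      exact hp1.tsum_eq
    rw [ENNReal.toReal_ofNat, Real.rpow_two] at h
    exact (pow_eq_one_iff_of_nonneg (norm_nonneg _) two_ne_zero).1 h
  · rw [hξx, hpN x hx, Real.sqrt_zero, Complex.ofReal_zero]
  · refine lt_of_pow_lt_pow_left₀ 2 hε.le (lt_of_le_of_lt ?_ (hpF s hs))
    have h2 := lp.hasSum_norm (p := 2) (by norm_num) (leftRegular G (s : G) ξ - ξ)
    have h1 := lp.hasSum_norm (p := 1) (by norm_num) (ellOneTranslate (s : G) p - p)
    rw [ENNReal.toReal_ofNat, Real.rpow_two] at h2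
    rw [ENNReal.toReal_one, Real.rpow_one] at h1
    refine hasSum_le (fun x => ?_) h2 h1
    change ‖((√(p ((s : G)⁻¹ * x)) : ℝ) : ℂ) - ((√(p x) : ℝ) : ℂ)‖ ^ (2 : ℝ) ≤
      ‖p ((s : G)⁻¹ * x) - p x‖ ^ (1 : ℝ)
    rw [← Complex.ofReal_sub, Complex.norm_real, Real.rpow_two, Real.rpow_one, Real.norm_eq_abs,
      sq_abs]
    exact sq_sqrt_sub_sqrt_le (hp0 _) (hp0 _)

open Classical in
/-- The indicator function of an amenable normal subgroup extends to a tracial state of the reduced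
group C*-algebra. -/
theorem exists_isTracialState_of_amenable {N : Subgroup G} (hnorm : N.Normal)
    (hN : IsAmenableGroup N) :
    ∃ τ : reducedGroupCStar G →ₗ[ℂ] ℂ, IsTracialState τ ∧
      ∀ t, τ (reducedGroupCStar.of t) = if t ∈ N then 1 else 0 := by
  choose ξ hξ1 hξN hξF using fun i : Finset N × ℕ =>
    exists_almost_invariant_vector hN i.1 (Nat.one_div_pos_of_nat (α := ℝ) (n := i.2))
  obtain ⟨τ, hτ, hτ1, hlim⟩ := exists_limit_vectorState Filter.atTop ξ hξ1
  have hval (t : G) : τ (leftRegular G t) = if t ∈ N then 1 else 0 := by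
    refine hlim _ _ ?_
    split_ifs with ht
    · rw [tendsto_iff_norm_sub_tendsto_zero]
      have hev : ∀ᶠ i : Finset N × ℕ in Filter.atTop,
          ‖inner ℂ (ξ i) (leftRegular G t (ξ i)) - 1‖ ≤ 1 / ((i.2 : ℝ) + 1) := by
        filter_upwards [Filter.eventually_ge_atTop ({⟨t, ht⟩}, 0)] with i hi
        have hmem : (⟨t, ht⟩ : N) ∈ i.1 := hi.1 (Finset.mem_singleton_self _)
        have hone : inner ℂ (ξ i) (ξ i) = 1 := by
          rw [inner_self_eq_norm_sq_to_K, hξ1]; simp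
        rw [← hone, ← inner_sub_right]
        refine (norm_inner_le_norm _ _).trans ?_
        rw [hξ1, one_mul]
        exact (hξF i _ hmem).le
      refine squeeze_zero' (Filter.Eventually.of_forall fun _ => norm_nonneg _) hev ?_
      rw [← Filter.prod_atTop_atTop_eq]
      exact tendsto_one_div_add_atTop_nhds_zero_nat.comp Filter.tendsto_snd
    -- For t outside N, ξ and its translate live on the disjoint cosets N and tN, so the inner
    -- product is exactly 0.
    · refine tendsto_const_nhds.congr fun i => ?_
      rw [lp.inner_eq_tsum]
      refine (((tsum_congr fun x => ?_).trans tsum_zero).symm)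
      rw [leftRegular_apply]
      by_cases hx : x ∈ N
      · have : t⁻¹ * x ∉ N := fun h => ht (by
          have := N.mul_mem hx (N.inv_mem h)
          rwa [mul_inv_rev, inv_inv, mul_inv_cancel_left] at this)
        rw [hξN i _ this, inner_zero_right]
      · rw [hξN i _ hx, inner_zero_left]
  refine ⟨_, isTracialState_restrict hτ hτ1 fun s t => ?_, hval⟩
  rw [hval, hval]
  -- Normality enters here: the indicator of N is a class function.
  simp only [hnorm.mem_comm_iff]

theorem isAmenableGroup_of_subsingleton (Γ : Type*) [Group Γ] [Subsingleton Γ] :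
    IsAmenableGroup Γ :=
  ⟨(WeakDual.toStrongDual (evalMean (1 : Γ))).toLinearMap, fun _ hf => hf 1, rfl,
    fun s f g hfg => (hfg 1).trans (by rw [Subsingleton.elim s 1, mul_one]; rfl)⟩

end Day

theorem theorem3p3 (G : Type*) [Group G] :
    IsGreatest {N : Subgroup G | N.Normal ∧ IsAmenableGroup N} (amenableRadical G) ∧
    (∀ t : G,
      (∀ τ : reducedGroupCStar G →ₗ[ℂ] ℂ, IsTracialState τ → τ (reducedGroupCStar.of t) = 0) ↔
        t ∉ amenableRadical G) ∧
    ((∃! τ : reducedGroupCStar G →ₗ[ℂ] ℂ, IsTracialState τ) ↔ amenableRadical G = ⊥) := by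
  have hgreatest : IsGreatest {N : Subgroup G | N.Normal ∧ IsAmenableGroup N}
      (amenableRadical G) := by
    obtain ⟨J, hJ⟩ := exists_minimal_closedLeftIdeal G
    rw [← actionKernel_eq_amenableRadical hJ]
    exact isGreatest_actionKernel hJ
  obtain ⟨τR, hτR, hτR_of⟩ := exists_isTracialState_of_amenable hgreatest.1.1 hgreatest.1.2
  obtain ⟨τ₁, hτ₁, hτ₁_of⟩ := exists_isTracialState_of_amenable
    (inferInstance : (⊥ : Subgroup G).Normal) (isAmenableGroup_of_subsingleton _)
  refine ⟨hgreatest, fun t => ⟨fun h ht => ?_, fun ht τ hτ => hτ.map_of_eq_zero ht⟩, fun h => ?_,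
    fun h => ⟨τ₁, hτ₁, fun τ hτ => hτ.ext hτ₁ fun t => ?_⟩⟩
  · have := h τR hτR
    rw [hτR_of, if_pos ht] at this
    exact one_ne_zero this
  · refine (Subgroup.eq_bot_iff_forall _).2 fun t ht => ?_
    by_contra hne
    have := hτR_of t
    -- A nontrivial t in the radical separates the two traces: one takes the value 1, the other 0.
    rw [h.unique hτR hτ₁, hτ₁_of, if_pos ht, if_neg (by rwa [Subgroup.mem_bot])] at this
    exact zero_ne_one this
  · by_cases ht : t = 1
    · rw [ht, reducedGroupCStar.of_one, hτ.map_one, hτ₁.map_one]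
    · have hmem : t ∉ amenableRadical G := by rwa [h, Subgroup.mem_bot]
      rw [hτ.map_of_eq_zero hmem, hτ₁.map_of_eq_zero hmem]
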